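/- Let $\Omega\subset\mathbb R^N$ be a bounded open set with Lipschitz boundary, and let $\mathbb R^{N\times N}_s$ be the space of symmetric real $N\times N$ matrices. Let $W_0,W_1:\mathbb R^{N\times N}_s\to\mathbb R$ be continuous and suppose that there are $\alpha,\beta>0$ such that $$\alpha|\xi|\le W_i(\xi)\le\beta(1+|\xi|)\qquad\text{for all }\xi\in\mathbb R^{N\times N}_s,\ i=0,1.$$ For an open set $A\subset\Omega$ let $BD(A)$ be the space of $u\in L^1(A;\mathbb R^N)$ whose symmetrised distributional gradient $Eu=\frac12(Du+Du^T)$ is a matrix-valued finite Radon measure on $A$, and let $LD(A)$ be the space of $u\in BD(A)$ such that $Eu=\mathcal E u\,\mathcal L^N$ with $\mathcal E u\in L^1(A;\mathbb R^{N\times N}_s)$. For $u\in LD(A)$ and $\chi\in BV(A;\{0,1\})$ put $$F(\chi,u;A)=\int_A\chi\,W_1(\mathcal E u)+(1-\chi)\,W_0(\mathcal E u)\,dx+|D\chi|(A),$$ and define $$\mathcal F(\chi,u;A)=\inf\Big\{\liminf_{n\to\infty}F(\chi_n,u_n;A):\ u_n\in W^{1,1}(A;\mathbb R^N),\ \chi_n\in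 BV(A;\{0,1\}),\ u_n\to u\text{ in }L^1(A;\mathbb R^N),\ \chi_n\to\chi\text{ in }L^1(A)\Big\},$$ and $\mathcal F_{LD}(\chi,u;A)$ in the same way with $u_n\in LD(A)$ in place of $u_n\in W^{1,1}(A;\mathbb R^N)$. Then $$\mathcal F(\chi,u;A)=\mathcal F_{LD}(\chi,u;A)$$ for every open set $A\subset\Omega$ with Lipschitz boundary, every $\chi\in BV(A;\{0,1\})$ and every $u\in BD(\Omega)$. -/

import Mathlib

open MeasureTheory Filter Topology
open scoped ENNReal NNReal ContDiff

noncomputable section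

namespace Relax

/-- `N`-dimensional Euclidean space. -/
abbrev Euc (N : ℕ) : Type := EuclideanSpace ℝ (Fin N)

/-- Real `N × N` matrices. -/
abbrev Mat (N : ℕ) : Type := Matrix (Fin N) (Fin N) ℝ

/-- The Euclidean (Frobenius) norm `|ξ|` of a matrix. -/
def matNorm {N : ℕ} (ξ : Mat N) : ℝ := Real.sqrt (∑ i, ∑ j, ξ i j ^ 2)

/-- The partial derivative of `φ` in the `j`-th coordinate direction. -/
def pderiv {N : ℕ} (j : Fin N) (φ : Euc N → ℝ) (x : Euc N) : ℝ :=
  fderiv ℝ φ x (EuclideanSpace.single j 1)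

/-- Scalar test functions: `φ ∈ C_c^∞(A)`. -/
structure IsTest {N : ℕ} (A : Set (Euc N)) (φ : Euc N → ℝ) : Prop where
  smooth : ContDiff ℝ ∞ φ
  compact : HasCompactSupport φ
  support : tsupport φ ⊆ A

/-- The integral of a function against a finite signed measure. -/
def signedIntegral {N : ℕ} (μ : SignedMeasure (Euc N)) (φ : Euc N → ℝ) : ℝ :=
  ∫ x, φ x ∂μ.toJordanDecomposition.posPart - ∫ x, φ x ∂μ.toJordanDecomposition.negPart

/-- `A` has Lipschitz boundary: near each boundary point, `A` is the set of points strictly above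
the graph of a Lipschitz function over the hyperplane orthogonal to some unit vector `ν`. -/
def LipschitzBoundary {N : ℕ} (A : Set (Euc N)) : Prop :=
  ∀ x₀ ∈ frontier A, ∃ r : ℝ, 0 < r ∧ ∃ ν : Euc N, ‖ν‖ = 1 ∧
    ∃ (K : ℝ≥0) (γ : Euc N → ℝ), LipschitzWith K γ ∧
      ∀ x ∈ Metric.ball x₀ r, x ∈ A ↔ γ (x - inner ℝ x ν • ν) < inner ℝ x ν

/-- `G` is the gradient of `u` on `A` in the sense of distributions, and it is in `L¹(A)`;
here `G i j` is the `j`-th partial derivative of the `i`-th component of `u`. -/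
def HasWeakGrad {N : ℕ} (A : Set (Euc N)) (u : Euc N → Euc N) (G : Euc N → Mat N) : Prop :=
  (∀ i j, IntegrableOn (fun x => G x i j) A) ∧
    ∀ i j, ∀ φ, IsTest A φ →
      ∫ x in A, u x i * pderiv j φ x = -∫ x in A, G x i j * φ x

/-- `G` is the symmetric part `(Du + Duᵀ)/2` of the distributional derivative of `u` on `A`,
and it is in `L¹(A)`. -/
def HasWeakSymGrad {N : ℕ} (A : Set (Euc N)) (u : Euc N → Euc N) (G : Euc N → Mat N) : Prop :=
  (∀ x, (G x).IsSymm) ∧ (∀ i j, IntegrableOn (fun x => G x i j) A) ∧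
    ∀ i j, ∀ φ, IsTest A φ →
      ∫ x in A, (u x i * pderiv j φ x + u x j * pderiv i φ x) / 2 = -∫ x in A, G x i j * φ x

/-- The Sobolev space `W^{1,1}(A; ℝ^N)`. -/
def MemW11 {N : ℕ} (A : Set (Euc N)) (u : Euc N → Euc N) : Prop :=
  IntegrableOn u A ∧ ∃ G, HasWeakGrad A u G

/-- The space `LD(A)`: integrable functions with integrable symmetrised distributional gradient. -/
def MemLD {N : ℕ} (A : Set (Euc N)) (u : Euc N → Euc N) : Prop :=
  IntegrableOn u A ∧ ∃ G, HasWeakSymGrad A u G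

/-- The space `BD(A)`: integrable functions whose symmetrised distributional gradient is a
matrix-valued finite Radon measure. -/
def MemBD {N : ℕ} (A : Set (Euc N)) (u : Euc N → Euc N) : Prop :=
  IntegrableOn u A ∧ ∃ μ : Fin N → Fin N → SignedMeasure (Euc N),
    ∀ i j, ∀ φ, IsTest A φ →
      ∫ x in A, (u x i * pderiv j φ x + u x j * pderiv i φ x) / 2 = -signedIntegral (μ i j) φ

/-- The space `BV(A; {0,1})`: integrable functions with values in `{0,1}` (almost everywhere in
`A`) whose distributional partial derivatives are finite Radon measures. -/
def MemBV01 {N : ℕ} (A : Set (Euc N)) (χ : Euc N → ℝ) : Prop :=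
  IntegrableOn χ A ∧ (∀ᵐ x ∂volume.restrict A, χ x = 0 ∨ χ x = 1) ∧
    ∃ μ : Fin N → SignedMeasure (Euc N),
      ∀ j, ∀ φ, IsTest A φ → ∫ x in A, χ x * pderiv j φ x = -signedIntegral (μ j) φ

/-- The total variation `|Dχ|(A)`: the supremum of `∫_A χ div φ` over all `φ ∈ C_c^1(A; ℝ^N)`
with `|φ| ≤ 1`. -/
def totalVar {N : ℕ} (A : Set (Euc N)) (χ : Euc N → ℝ) : ℝ≥0∞ :=
  ⨆ (φ : Euc N → Euc N) (_ : ContDiff ℝ 1 φ ∧ HasCompactSupport φ ∧ tsupport φ ⊆ A ∧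
      ∀ x, ‖φ x‖ ≤ 1),
    ENNReal.ofReal (∫ x in A, χ x * ∑ i, fderiv ℝ φ x (EuclideanSpace.single i 1) i)

open Classical in
/-- The density `ℰu` of `Eu` with respect to Lebesgue measure on `A`, for `u ∈ LD(A)` (unique up
to null sets of `A`); `0` if `u ∉ LD(A)`. -/
def symGrad {N : ℕ} (A : Set (Euc N)) (u : Euc N → Euc N) : Euc N → Mat N :=
  if h : ∃ G, HasWeakSymGrad A u G then h.choose else 0

/-- The energy `F(χ, u; A) = ∫_A χ W₁(ℰu) + (1 - χ) W₀(ℰu) dx + |Dχ|(A)`, for `u ∈ LD(A)` and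
`χ ∈ BV(A; {0,1})`, where `W₀` and `W₁` are nonnegative on symmetric matrices. -/
def energy {N : ℕ} (W₀ W₁ : Mat N → ℝ) (A : Set (Euc N)) (χ : Euc N → ℝ)
    (u : Euc N → Euc N) : ℝ≥0∞ :=
  (∫⁻ x in A, ENNReal.ofReal
      (χ x * W₁ (symGrad A u x) + (1 - χ x) * W₀ (symGrad A u x))) + totalVar A χ

/-- Convergence of a sequence in `L¹(A)`. -/
def TendstoL1 {N : ℕ} {V : Type*} [NormedAddCommGroup V] (A : Set (Euc N))
    (f : ℕ → Euc N → V) (g : Euc N → V) : Prop :=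
  Tendsto (fun n => ∫⁻ x in A, ‖f n x - g x‖ₑ) atTop (𝓝 0)

/-- The relaxed energy of `(χ, u)` on `A` along sequences `u_n` in a class `X` of functions:
the infimum of `liminf F(χ_n, u_n; A)` over `u_n ∈ X`, `χ_n ∈ BV(A; {0,1})` with `u_n → u` and
`χ_n → χ` in `L¹(A)`. -/
def relaxedAlong {N : ℕ} (X : (Euc N → Euc N) → Prop) (W₀ W₁ : Mat N → ℝ) (A : Set (Euc N))
    (χ : Euc N → ℝ) (u : Euc N → Euc N) : ℝ≥0∞ :=
  sInf {ℓ | ∃ (un : ℕ → Euc N → Euc N) (χn : ℕ → Euc N → ℝ),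
    (∀ n, X (un n)) ∧ (∀ n, MemBV01 A (χn n)) ∧ TendstoL1 A un u ∧ TendstoL1 A χn χ ∧
      ℓ = liminf (fun n => energy W₀ W₁ A (χn n) (un n)) atTop}

/-- The relaxation `𝓕(χ, u; A)` along `W^{1,1}` sequences. -/
def relaxedW11 {N : ℕ} (W₀ W₁ : Mat N → ℝ) (A : Set (Euc N)) (χ : Euc N → ℝ)
    (u : Euc N → Euc N) : ℝ≥0∞ :=
  relaxedAlong (MemW11 A) W₀ W₁ A χ u

/-- The relaxation `𝓕_LD(χ, u; A)` along `LD` sequences. -/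
def relaxedLD {N : ℕ} (W₀ W₁ : Mat N → ℝ) (A : Set (Euc N)) (χ : Euc N → ℝ)
    (u : Euc N → Euc N) : ℝ≥0∞ :=
  relaxedAlong (MemLD A) W₀ W₁ A χ u

end Relax

end

/-!
A relaxation along a larger class of maps is smaller, and `W^{1,1}(A)` is contained in `LD(A)`, so
one inequality is plain. For the other, every `u ∈ LD(A)` is approximated by maps that are smooth
on the whole space, hence in `W^{1,1}(A)` because `A` is bounded, such that the maps converge in
`L¹(A)` and their symmetrised gradients converge in `L¹(A)` to that of `u`
(`exists_contDiff_tendsto_symDeriv`). By continuity and linear growth of `W₀` and `W₁` the bulk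
energy passes to the limit, and `χ`, with its total variation, is left alone; see
`frequently_lintegral_density_le` and `MemLD.exists_memW11_energy_le`. Applied to each member of a
sequence admissible for the relaxation in `LD(A)`, with errors tending to zero, this gives a
sequence in `W^{1,1}(A)` with the same limit and no larger inferior limit of the energies.

Interior regularisation would not suffice, since there is no Korn inequality in `L¹`: a map that is
smooth in `A` with integrable symmetrised gradient need not have an integrable gradient. The
Lipschitz boundary allows smoothing up to the boundary. Near a boundary point a cone of directions
points into `A` (`LipschitzBoundary.exists_isAdapted_ball`), and `φ u`, for a cutoff `φ` supported
there, is extended by zero and convolved with a kernel `κ` carried by the opposite cone. For `x ∈ A`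
the function `y ↦ κ (x - y) φ y` is then a test function in `A`, so the symmetrised gradient of the
mollified map at `x` is read off from the weak formulation for `u`: it is the mollification of
`φ ℰu` plus the symmetrised product of `u` and `∇φ` (`symDeriv_convolution`). A partition of unity
glues the pieces, and the terms with `∇φ` cancel.
-/

namespace Relax

/-! ### Mollification -/

/-- Translation is continuous in `L¹`, as an estimate at the origin. -/
theorem exists_forall_lintegral_translate_sub_le {N : ℕ} {f : Euc N → ℝ} (hf : Integrable f)
    {ε : ℝ≥0∞} (hε : 0 < ε) :
    ∃ δ : ℝ, 0 < δ ∧ ∀ s : Euc N, ‖s‖ < δ → ∫⁻ x, ‖f (x - s) - f x‖ₑ ≤ ε := by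
  have : Fact ((1 : ℝ≥0∞) ≠ ⊤) := ⟨ENNReal.one_ne_top⟩
  set F : Lp ℝ 1 (volume : Measure (Euc N)) := hf.toL1 f with hF
  have hc : Continuous fun s : Euc N => DomAddAct.mk (-s) +ᵥ F :=
    (DomAddAct.continuous_mk.comp continuous_neg).vadd continuous_const
  have h0 : Tendsto (fun s : Euc N => edist (DomAddAct.mk (-s) +ᵥ F) F) (𝓝 0) (𝓝 0) := by
    have := (hc.edist (continuous_const (y := F))).tendsto 0
    simpa using this
  obtain ⟨δ, hδ, h⟩ := Metric.eventually_nhds_iff.1 ((ENNReal.tendsto_nhds_zero.1 h0) ε hε)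
  refine ⟨δ, hδ, fun s hs => ?_⟩
  have h1 := h (y := s) (by simpa using hs)
  rw [Lp.edist_def, eLpNorm_one_eq_lintegral_enorm] at h1
  refine le_of_eq_of_le (lintegral_congr_ae ?_) h1
  have e1 := hf.coeFn_toL1
  have e2 := DomAddAct.vadd_Lp_ae_eq (DomAddAct.mk (-s)) F
  have e3 := (measurePreserving_vadd (-s)
    (volume : Measure (Euc N))).quasiMeasurePreserving.ae_eq_comp e1
  filter_upwards [e1, e2, e3] with x h1 h2 h3
  have h3' : F (-s +ᵥ x) = f (x - s) := by
    rw [sub_eq_neg_add]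
    exact h3
  rw [Pi.sub_apply, h2, h1, ← h3']
  rfl

open scoped Convolution in
/-- A mollification is an average of translates: a probability density carried by the ball of
radius `δ` moves `f` in `L¹` by at most the supremum over translations of length less than `δ`. -/
theorem lintegral_convolution_sub_le {N : ℕ} {f κ : Euc N → ℝ} (hf : Integrable f)
    (hκ : ∀ s, 0 ≤ κ s) (hκc : Continuous κ) (hκs : HasCompactSupport κ) (hκ1 : ∫ s, κ s = 1)
    {δ : ℝ} {ε : ℝ≥0∞} (hκδ : ∀ s, κ s ≠ 0 → ‖s‖ < δ)
    (h : ∀ s : Euc N, ‖s‖ < δ → ∫⁻ x, ‖f (x - s) - f x‖ₑ ≤ ε) :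
    ∫⁻ x, ‖(κ ⋆[ContinuousLinearMap.mul ℝ ℝ] f) x - f x‖ₑ ≤ ε := by
  have hκi : Integrable κ := hκc.integrable_of_hasCompactSupport hκs
  have hκl : ∫⁻ s, ‖κ s‖ₑ = 1 := by
    have := ofReal_integral_eq_lintegral_ofReal hκi (ae_of_all _ hκ)
    rw [hκ1, ENNReal.ofReal_one] at this
    rw [this]
    exact lintegral_congr fun s => by rw [Real.enorm_eq_ofReal (hκ s)]
  have hm : AEMeasurable (fun p : Euc N × Euc N => ‖κ p.2 * (f (p.1 - p.2) - f p.1)‖ₑ)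
      (volume.prod volume) := by
    have h1 : AEStronglyMeasurable (fun p : Euc N × Euc N => f (p.1 - p.2)) (volume.prod volume) :=
      hf.aestronglyMeasurable.comp_quasiMeasurePreserving
        (quasiMeasurePreserving_sub_of_right_invariant volume volume)
    exact ((hκc.comp continuous_snd).aestronglyMeasurable.mul
      (h1.sub hf.aestronglyMeasurable.comp_fst)).enorm
  calc ∫⁻ x, ‖(κ ⋆[ContinuousLinearMap.mul ℝ ℝ] f) x - f x‖ₑ
      ≤ ∫⁻ x, ∫⁻ s, ‖κ s * (f (x - s) - f x)‖ₑ := by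
        refine lintegral_mono_ae ?_
        have hce := (hκi.ae_convolution_exists (ContinuousLinearMap.mul ℝ ℝ) hf)
        filter_upwards [hce] with x hx
        have : (κ ⋆[ContinuousLinearMap.mul ℝ ℝ] f) x - f x = ∫ s, κ s * (f (x - s) - f x) := by
          have h2 : ∫ s, κ s * f x = f x := by rw [integral_mul_const, hκ1, one_mul]
          rw [convolution_def]
          conv_lhs => rw [← h2]
          rw [← integral_sub hx (hκi.mul_const _)]
          exact integral_congr_ae (ae_of_all _ fun s => by simp [mul_sub])
        rw [this]
        exact enorm_integral_le_lintegral_enorm _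
    _ = ∫⁻ s, ∫⁻ x, ‖κ s * (f (x - s) - f x)‖ₑ := lintegral_lintegral_swap hm
    _ ≤ ∫⁻ s, ‖κ s‖ₑ * ε := by
        refine lintegral_mono fun s => ?_
        simp only [enorm_mul]
        rw [lintegral_const_mul' _ _ enorm_ne_top]
        by_cases hs : κ s = 0
        · simp [hs]
        · gcongr
          exact h s (hκδ s hs)
    _ = ε := by
        rw [lintegral_mul_const _ hκc.enorm.measurable, hκl, one_mul]

open scoped Convolution in
theorem contDiff_convolution {N : ℕ} {f κ : Euc N → ℝ} (hf : Integrable f)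
    (hκ : ContDiff ℝ ∞ κ) (hκs : HasCompactSupport κ) :
    ContDiff ℝ ∞ (κ ⋆[ContinuousLinearMap.mul ℝ ℝ] f) :=
  hκs.contDiff_convolution_left _ hκ hf.locallyIntegrable

open scoped Convolution in
theorem pderiv_convolution {N : ℕ} {f κ : Euc N → ℝ} (hf : Integrable f)
    (hκ : ContDiff ℝ ∞ κ) (hκs : HasCompactSupport κ) (j : Fin N) (x : Euc N) :
    pderiv j (κ ⋆[ContinuousLinearMap.mul ℝ ℝ] f) x = ∫ y, pderiv j κ (x - y) * f y := by
  have h := hκs.hasFDerivAt_convolution_left (ContinuousLinearMap.mul ℝ ℝ)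
    (hκ.of_le (by simp)) hf.locallyIntegrable x
  have hex : ConvolutionExistsAt (fderiv ℝ κ) f x
      ((ContinuousLinearMap.mul ℝ ℝ).precompL (Euc N)) volume :=
    (hκs.fderiv ℝ).convolutionExists_left _ (hκ.continuous_fderiv (by simp))
      hf.locallyIntegrable x
  rw [pderiv, h.fderiv, convolution_eq_swap, ContinuousLinearMap.integral_apply]
  · rfl
  · exact hex.integrable_swap

/-! ### The symmetrised gradient of a localised mollification -/

/-- The symmetrised classical gradient of a vector field. -/
noncomputable def symDeriv {N : ℕ} (v : Euc N → Euc N) (x : Euc N) : Mat N :=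
  Matrix.of fun i j => (pderiv j (fun y => v y i) x + pderiv i (fun y => v y j) x) / 2

theorem continuous_pderiv {N : ℕ} {φ : Euc N → ℝ} (hφ : ContDiff ℝ ∞ φ) (j : Fin N) :
    Continuous (pderiv j φ) :=
  (hφ.continuous_fderiv (by simp)).clm_apply continuous_const

theorem integrableOn_mul_of_hasCompactSupport {N : ℕ} {A : Set (Euc N)} {f φ : Euc N → ℝ}
    (hf : IntegrableOn f A) (hφ : Continuous φ) (hφs : HasCompactSupport φ) :
    IntegrableOn (fun x => f x * φ x) A := by
  obtain ⟨C, hC⟩ := hφ.bounded_above_of_compact_support hφs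
  exact Integrable.mul_bdd (c := C) hf hφ.aestronglyMeasurable (ae_of_all _ hC)

theorem hasCompactSupport_pderiv {N : ℕ} {φ : Euc N → ℝ} (hφ : HasCompactSupport φ) (j : Fin N) :
    HasCompactSupport (pderiv j φ) :=
  hφ.fderiv_apply (𝕜 := ℝ) _

theorem integrableOn_component {N : ℕ} {A : Set (Euc N)} {u : Euc N → Euc N}
    (hu : IntegrableOn u A) (i : Fin N) : IntegrableOn (fun x => u x i) A :=
  (EuclideanSpace.proj (𝕜 := ℝ) i).integrable_comp hu

open scoped Convolution in
/-- The symmetrised gradient of `κ * (1_A φ u)` at a point `x` of `A` is the mollification of the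
distributional one of `φ u`, provided `y ↦ κ (x - y) φ y` is supported in `A`: the identity is the
definition of the weak symmetrised gradient of `u` tested with that function. No regularity of
the zero extension across the boundary of `A` enters. -/
theorem symDeriv_convolution {N : ℕ} {A : Set (Euc N)} (hA : IsOpen A) {u : Euc N → Euc N}
    {G : Euc N → Mat N} (hu : IntegrableOn u A) (hG : HasWeakSymGrad A u G) {φ κ : Euc N → ℝ}
    (hφ : ContDiff ℝ ∞ φ) (hφs : HasCompactSupport φ)
    (hκ : ContDiff ℝ ∞ κ) (hκs : HasCompactSupport κ) {x : Euc N}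
    (h : ∀ y ∈ tsupport φ, x - y ∈ tsupport κ → y ∈ A) (i j : Fin N) :
    (pderiv j (κ ⋆[ContinuousLinearMap.mul ℝ ℝ] A.indicator fun y => u y i * φ y) x +
      pderiv i (κ ⋆[ContinuousLinearMap.mul ℝ ℝ] A.indicator fun y => u y j * φ y) x) / 2 =
    (κ ⋆[ContinuousLinearMap.mul ℝ ℝ] A.indicator fun y =>
      G y i j * φ y + (u y i * pderiv j φ y + u y j * pderiv i φ y) / 2) x := by
  set ψ : Euc N → ℝ := fun y => κ (x - y) * φ y with hψ
  have hκx : ContDiff ℝ ∞ fun y => κ (x - y) := hκ.comp (contDiff_const.sub contDiff_id)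
  have hψt : IsTest A ψ := by
    refine ⟨hκx.mul hφ, hφs.mul_left, fun y hy => h y (tsupport_mul_subset_right hy) ?_⟩
    exact tsupport_comp_subset_preimage κ (continuous_const.sub continuous_id)
      (tsupport_mul_subset_left hy)
  have hψy : ∀ y, ψ y = κ (x - y) * φ y := fun y => rfl
  have hd : ∀ (k : Fin N) (y : Euc N),
      pderiv k ψ y = κ (x - y) * pderiv k φ y - pderiv k κ (x - y) * φ y := by
    intro k y
    have h1 : HasFDerivAt (fun y => κ (x - y)) (-(fderiv ℝ κ (x - y))) y := by
      have := ((hκ.differentiable (by simp)) (x - y)).hasFDerivAt.comp y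
        ((hasFDerivAt_const x y).sub (hasFDerivAt_id y))
      refine HasFDerivAt.congr_fderiv this ?_
      ext v
      simp
    have h2 := h1.mul ((hφ.differentiable (by simp)) y).hasFDerivAt
    rw [pderiv, pderiv, pderiv, hψ]
    erw [h2.fderiv]
    simp
    ring
  have hmi : ∀ {f : Euc N → ℝ}, IntegrableOn f A → ∀ k,
      IntegrableOn (fun y => f y * pderiv k ψ y) A := fun hf k =>
    integrableOn_mul_of_hasCompactSupport hf (continuous_pderiv hψt.smooth k)
      (hasCompactSupport_pderiv hψt.compact k)
  have hui := integrableOn_component hu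
  have hw : ∀ k, Integrable (A.indicator fun y => u y k * φ y) := fun k =>
    (integrableOn_mul_of_hasCompactSupport (hui k) hφ.continuous hφs).integrable_indicator
      hA.measurableSet
  rw [pderiv_convolution (hw i) hκ hκs, pderiv_convolution (hw j) hκ hκs, convolution_eq_swap]
  have key := hG.2.2 i j ψ hψt
  have e1 : ∀ f g : Euc N → ℝ, ∫ y, f y * A.indicator g y = ∫ y in A, f y * g y := fun f g => by
    rw [← integral_indicator hA.measurableSet]
    exact integral_congr_ae (ae_of_all _ fun y => by by_cases hy : y ∈ A <;> simp [hy])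
  have e2 : ∀ k l, IntegrableOn (fun y => pderiv l κ (x - y) * (u y k * φ y)) A := by
    intro k l
    have : IntegrableOn (fun y => u y k * (pderiv l κ (x - y) * φ y)) A :=
      integrableOn_mul_of_hasCompactSupport (hui k)
        (((continuous_pderiv hκ l).comp (continuous_const.sub continuous_id)).mul hφ.continuous)
        hφs.mul_left
    exact this.congr_fun (fun y _ => by ring) hA.measurableSet
  have e3 : ∀ k l, IntegrableOn (fun y => u y k * pderiv l ψ y) A := fun k l => hmi (hui k) l
  have e4 : IntegrableOn (fun y => G y i j * ψ y) A :=
    integrableOn_mul_of_hasCompactSupport (hG.2.1 i j) hψt.smooth.continuous hψt.compact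
  simp only [ContinuousLinearMap.mul_apply', e1]
  rw [← integral_add (e2 i j) (e2 j i), ← integral_div]
  have e5 : IntegrableOn (fun y => (u y i * pderiv j ψ y + u y j * pderiv i ψ y) / 2) A :=
    ((e3 i j).add (e3 j i)).div_const 2
  have e6 : ∫ y in A, ((u y i * pderiv j ψ y + u y j * pderiv i ψ y) / 2 + G y i j * ψ y) = 0 := by
    rw [integral_add e5 e4, key]; ring
  have e7 : IntegrableOn (fun y => (u y i * pderiv j ψ y + u y j * pderiv i ψ y) / 2 +
      G y i j * ψ y) A := e5.add e4
  -- after subtracting the weak formulation tested with `ψ`, the integrands agree pointwise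
  rw [← sub_zero (∫ y in A, κ (x - y) * _), ← e6, ← integral_sub _ e7]
  · refine integral_congr_ae (ae_of_all _ fun y => ?_)
    simp only [hd, hψy]
    ring
  · refine (((((e2 i j).add (e2 j i)).div_const 2).add (e5.add e4))).congr
      (ae_of_all _ fun y => ?_)
    simp only [hd, hψy, Pi.add_apply]
    ring

/-- `S` is adapted to `A`: for some cone of directions, the balls of radius `c` around a vector `ν`,
a short step from a point of `A` along the cone that ends in `S` ends in `A`. The case `ν = 0` is
allowed, and covers the sets `S ⊆ A`. -/
def IsAdapted {N : ℕ} (A : Set (Euc N)) (S : Set (Euc N)) : Prop :=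
  ∃ (ν : Euc N) (c t₀ : ℝ), 0 < c ∧ 0 < t₀ ∧ ∀ t, 0 < t → t < t₀ → ∀ x ∈ A,
    ∀ z ∈ Metric.closedBall ν c, x + t • z ∈ S → x + t • z ∈ A

/-- Mollifying with a bump centred at `-t ν` of radius `t c` evaluates a function supported in `S`
along the cone of `S`, so from `A` only points of `A` are seen. -/
theorem IsAdapted.exists_kernel {N : ℕ} {A S : Set (Euc N)} (h : IsAdapted A S)
    {δ : ℝ} (hδ : 0 < δ) :
    ∃ κ : Euc N → ℝ, ContDiff ℝ ∞ κ ∧ HasCompactSupport κ ∧ (∀ s, 0 ≤ κ s) ∧ ∫ s, κ s = 1 ∧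
      (∀ s, κ s ≠ 0 → ‖s‖ < δ) ∧ ∀ x ∈ A, ∀ y ∈ S, x - y ∈ tsupport κ → y ∈ A := by
  obtain ⟨ν, c, t₀, hc, ht₀, h⟩ := h
  have hp : 0 < ‖ν‖ + c + 1 := by positivity
  obtain ⟨t, ht, ht'⟩ := exists_between (show 0 < min t₀ (δ / (‖ν‖ + c + 1)) by positivity)
  have ht1 : t < t₀ := ht'.trans_le (min_le_left _ _)
  have ht2 : t * (‖ν‖ + c + 1) < δ := (lt_div_iff₀ hp).1 (ht'.trans_le (min_le_right _ _))
  let b : ContDiffBump (-(t • ν)) := ⟨t * c / 2, t * c, by positivity, by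
    have : 0 < t * c := by positivity
    linarith⟩
  refine ⟨b.normed volume, b.contDiff_normed, b.hasCompactSupport_normed, b.nonneg_normed,
    b.integral_normed, fun s hs => ?_, fun x hx y hy hxy => ?_⟩
  · have : s ∈ Function.support (b.normed volume) := hs
    rw [b.support_normed_eq, mem_ball_iff_norm] at this
    have h1 : ‖s‖ ≤ ‖s - -(t • ν)‖ + ‖t • ν‖ := by
      have := norm_sub_le (s - -(t • ν)) (t • ν)
      simpa using this
    rw [norm_smul, Real.norm_of_nonneg ht.le] at h1
    have h2 : b.rOut = t * c := rfl
    nlinarith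
  · rw [b.tsupport_normed_eq, mem_closedBall_iff_norm] at hxy
    have h2 : b.rOut = t * c := rfl
    have hy' : x + t • (t⁻¹ • (y - x)) = y := by
      rw [smul_inv_smul₀ ht.ne']; abel
    have := h t ht ht1 x hx (t⁻¹ • (y - x)) ?_
    · rw [hy'] at this
      exact this hy
    · rw [mem_closedBall_iff_norm]
      have h3 : t⁻¹ • (y - x) - ν = -(t⁻¹ • (x - y - -(t • ν))) := by
        rw [sub_neg_eq_add, smul_add, inv_smul_smul₀ ht.ne', smul_sub, smul_sub]; abel
      rw [h3, norm_neg, norm_smul, norm_inv, Real.norm_of_nonneg ht.le]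
      rw [h2] at hxy
      rwa [inv_mul_le_iff₀ ht]

/-! ### Smooth approximation on domains with Lipschitz boundary -/

theorem IsAdapted.mono {N : ℕ} {A S T : Set (Euc N)} (h : IsAdapted A T) (hST : S ⊆ T)  :
    IsAdapted A S := by
  obtain ⟨ν, c, t₀, hc, ht₀, h⟩ := h
  exact ⟨ν, c, t₀, hc, ht₀, fun t ht ht' x hx z hz hxz => h t ht ht' x hx z hz (hST hxz)⟩

/-- Above a `K`-Lipschitz graph over the hyperplane orthogonal to `ν`, the cone around `ν` of
opening `c = 1 / (2 (K + 1))` points into the domain: a step `t (ν + e)` with `|e| ≤ c` raises the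
height by at least `t (1 - c)` and the graph by at most `2 c K t`. -/
theorem LipschitzBoundary.exists_isAdapted_ball {N : ℕ} {A : Set (Euc N)}
    (hAl : LipschitzBoundary A) {x₀ : Euc N} (hx₀ : x₀ ∈ frontier A) :
    ∃ r : ℝ, 0 < r ∧ IsAdapted A (Metric.ball x₀ r) := by
  obtain ⟨r, hr, ν, hν, K, γ, hγ, h⟩ := hAl x₀ hx₀
  have hK : (0 : ℝ) ≤ K := K.2
  set c : ℝ := 1 / (2 * (K + 1)) with hc
  have hc0 : 0 < c := by positivity
  have hcK : c * (2 * (K + 1)) = 1 := by rw [hc]; field_simp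
  have ht0 : 0 < r / 2 / (1 + c) := by positivity
  refine ⟨r / 2, half_pos hr, ν, c, r / 2 / (1 + c), hc0, ht0, fun t ht ht' x hx z hz hy => ?_⟩
  rw [mem_closedBall_iff_norm] at hz
  rw [lt_div_iff₀ (by positivity)] at ht'
  set y := x + t • z with hy_def
  have hyx : y - x = t • z := by rw [hy_def]; abel
  have hzn : ‖z‖ ≤ 1 + c := by
    calc ‖z‖ = ‖ν + (z - ν)‖ := by congr 1; abel
      _ ≤ ‖ν‖ + ‖z - ν‖ := norm_add_le _ _
      _ ≤ 1 + c := by rw [hν]; linarith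
  -- the graph describes `A` only in the ball of radius `r`; for short steps ending in the half
  -- ball, the starting point is still there
  have hxr : x ∈ Metric.ball x₀ r := by
    rw [mem_ball_iff_norm] at hy ⊢
    calc ‖x - x₀‖ = ‖(y - x₀) - t • z‖ := by rw [← hyx]; congr 1; abel
      _ ≤ ‖y - x₀‖ + ‖t • z‖ := norm_sub_le _ _
      _ < r := by
        rw [norm_smul, Real.norm_of_nonneg ht.le]
        nlinarith
  have hyr : y ∈ Metric.ball x₀ r := Metric.ball_subset_ball (by linarith) hy
  rw [h y hyr]
  have hx' := (h x hxr).1 hx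
  set e := z - ν with he
  have hin : inner ℝ y ν = inner ℝ x ν + t * (1 + inner ℝ e ν) := by
    have hz' : z = ν + e := by rw [he]; abel
    rw [hy_def, hz', inner_add_left, inner_smul_left, inner_add_left,
      real_inner_self_eq_norm_sq, hν]
    simp
  have hie : |inner ℝ e ν| ≤ c := by
    have := abs_real_inner_le_norm e ν
    rw [hν, mul_one] at this
    exact this.trans hz
  have hdist : ‖(y - inner ℝ y ν • ν) - (x - inner ℝ x ν • ν)‖ ≤ t * (2 * c) := by
    have : (y - inner ℝ y ν • ν) - (x - inner ℝ x ν • ν) = t • (e - inner ℝ e ν • ν) := by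
      have hz' : z = ν + e := by rw [he]; abel
      rw [hin, hy_def, hz']
      module
    rw [this, norm_smul, Real.norm_of_nonneg ht.le]
    gcongr
    calc ‖e - inner ℝ e ν • ν‖ ≤ ‖e‖ + ‖inner ℝ e ν • ν‖ := norm_sub_le _ _
      _ ≤ c + c := by
        rw [norm_smul, hν, mul_one, Real.norm_eq_abs]
        exact add_le_add hz hie
      _ = 2 * c := by ring
  have hγ' := hγ.dist_le_mul (y - inner ℝ y ν • ν) (x - inner ℝ x ν • ν)
  rw [dist_eq_norm, dist_eq_norm, Real.norm_eq_abs] at hγ'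
  have h1 := le_abs_self (γ (y - inner ℝ y ν • ν) - γ (x - inner ℝ x ν • ν))
  have h2 := mul_le_mul_of_nonneg_left hdist hK
  have h3 := neg_abs_le (inner ℝ e ν)
  have h4 : t * (2 * c * K) < t * (1 + inner ℝ e ν) := by
    have : 2 * c * K < 1 + inner ℝ e ν := by nlinarith
    gcongr
  linarith

theorem exists_isAdapted_ball_of_mem {N : ℕ} {A : Set (Euc N)} (hA : IsOpen A) {x₀ : Euc N}
    (hx₀ : x₀ ∈ A) : ∃ r : ℝ, 0 < r ∧ IsAdapted A (Metric.ball x₀ r) := by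
  obtain ⟨r, hr, h⟩ := Metric.isOpen_iff.1 hA x₀ hx₀
  exact ⟨r, hr, 0, 1, 1, one_pos, one_pos, fun t _ _ x _ z _ hz => h hz⟩

open scoped Manifold in
/-- Smooth cutoffs adapted to `A` that sum to one on `A`, by compactness of its closure. -/
theorem LipschitzBoundary.exists_adapted_partition {N : ℕ} {A : Set (Euc N)} (hA : IsOpen A)
    (hAb : Bornology.IsBounded A) (hAl : LipschitzBoundary A) :
    ∃ (ι : Type) (_ : Fintype ι) (φ : ι → Euc N → ℝ),
      (∀ k, ContDiff ℝ ∞ (φ k) ∧ HasCompactSupport (φ k) ∧ IsAdapted A (tsupport (φ k))) ∧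
      ∀ x ∈ A, ∑ k, φ k x = 1 := by
  have hloc : ∀ x ∈ closure A, ∃ r : ℝ, 0 < r ∧ IsAdapted A (Metric.ball x r) := by
    intro x hx
    by_cases hxA : x ∈ A
    · exact exists_isAdapted_ball_of_mem hA hxA
    · exact hAl.exists_isAdapted_ball ⟨hx, by rwa [hA.interior_eq]⟩
  choose! r hr hball using hloc
  have hcpt : IsCompact (closure A) := hAb.isCompact_closure
  obtain ⟨T, hT, hcov⟩ := hcpt.elim_nhds_subcover (fun x => Metric.ball x (r x))
    fun x hx => Metric.ball_mem_nhds x (hr x hx)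
  obtain ⟨f, hf⟩ := SmoothPartitionOfUnity.exists_isSubordinate 𝓘(ℝ, Euc N) (s := closure A)
    isClosed_closure (fun x : T => Metric.ball (x : Euc N) (r x)) (fun x => Metric.isOpen_ball)
    (by simpa [Set.iUnion_subtype] using hcov)
  refine ⟨T, inferInstance, fun k => f k, fun k => ⟨(f k).contMDiff.contDiff, ?_, ?_⟩,
    fun x hx => ?_⟩
  · exact Metric.isCompact_of_isClosed_isBounded (isClosed_tsupport _)
      (Metric.isBounded_ball.subset (hf k))
  · exact (hball k (hT k k.2)).mono (hf k)
  · rw [← finsum_eq_sum_of_fintype]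
    exact f.sum_eq_one (subset_closure hx)

theorem pderiv_sum {N : ℕ} {ι : Type*} [Fintype ι] {φ : ι → Euc N → ℝ}
    (hφ : ∀ k, ContDiff ℝ ∞ (φ k)) (j : Fin N) (x : Euc N) :
    pderiv j (fun y => ∑ k, φ k y) x = ∑ k, pderiv j (φ k) x := by
  unfold pderiv
  rw [fderiv_fun_sum fun k _ => (hφ k).differentiable (by simp) x]
  simp

open scoped Convolution in
theorem tendsto_convolution {N : ℕ} {f : Euc N → ℝ} {κ : ℕ → Euc N → ℝ} (hf : Integrable f)
    (hκ : ∀ n s, 0 ≤ κ n s) (hκc : ∀ n, Continuous (κ n)) (hκs : ∀ n, HasCompactSupport (κ n))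
    (hκ1 : ∀ n, ∫ s, κ n s = 1) (hκδ : ∀ n s, κ n s ≠ 0 → ‖s‖ < 1 / ((n : ℝ) + 1)) :
    Tendsto (fun n => ∫⁻ x, ‖(κ n ⋆[ContinuousLinearMap.mul ℝ ℝ] f) x - f x‖ₑ) atTop (𝓝 0) := by
  rw [ENNReal.tendsto_nhds_zero]
  intro ε hε
  obtain ⟨δ, hδ, h⟩ := exists_forall_lintegral_translate_sub_le hf hε
  filter_upwards [(tendsto_one_div_add_atTop_nhds_zero_nat (𝕜 := ℝ)).eventually_lt_const hδ]
    with n hn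
  exact lintegral_convolution_sub_le hf (hκ n) (hκc n) (hκs n) (hκ1 n)
    (fun s hs => (hκδ n s hs).trans hn) h

theorem tendsto_lintegral_enorm_sum_sub {N : ℕ} {ι : Type*} [Fintype ι] {A : Set (Euc N)}
    (hA : MeasurableSet A) {a : ι → ℕ → Euc N → ℝ} {b : ι → Euc N → ℝ} {F : ℕ → Euc N → ℝ}
    {F' : Euc N → ℝ} (ha : ∀ k n, Continuous (a k n)) (hb : ∀ k, Integrable (b k))
    (hab : ∀ k, Tendsto (fun n => ∫⁻ x, ‖a k n x - b k x‖ₑ) atTop (𝓝 0))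
    (hF : ∀ n, ∀ x ∈ A, F n x = ∑ k, a k n x) (hF' : ∀ x ∈ A, F' x = ∑ k, b k x) :
    Tendsto (fun n => ∫⁻ x in A, ‖F n x - F' x‖ₑ) atTop (𝓝 0) := by
  have h0 : Tendsto (fun n => ∑ k, ∫⁻ x, ‖a k n x - b k x‖ₑ) atTop (𝓝 0) := by
    simpa using tendsto_finsetSum Finset.univ fun k _ => hab k
  refine tendsto_of_tendsto_of_tendsto_of_le_of_le tendsto_const_nhds h0 (fun _ => zero_le)
    fun n => ?_
  calc ∫⁻ x in A, ‖F n x - F' x‖ₑ ≤ ∫⁻ x in A, ∑ k, ‖a k n x - b k x‖ₑ := by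
        refine setLIntegral_mono' hA fun x hx => ?_
        rw [hF n x hx, hF' x hx, ← Finset.sum_sub_distrib]
        exact enorm_sum_le _ _
    _ ≤ ∫⁻ x, ∑ k, ‖a k n x - b k x‖ₑ := setLIntegral_le_lintegral _ _
    _ = ∑ k, ∫⁻ x, ‖a k n x - b k x‖ₑ := lintegral_finsetSum' _ fun k _ =>
        ((ha k n).aestronglyMeasurable.sub (hb k).aestronglyMeasurable).enorm

open scoped Convolution in
/-- Smooth maps on the whole space are dense in `LD(A)`: each piece `φ u` of a partition of unity is
mollified along its own cone. -/
theorem exists_contDiff_tendsto_symDeriv {N : ℕ} {A : Set (Euc N)} (hA : IsOpen A)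
    (hAb : Bornology.IsBounded A) (hAl : LipschitzBoundary A) {u : Euc N → Euc N}
    {G : Euc N → Mat N} (hu : IntegrableOn u A) (hG : HasWeakSymGrad A u G) :
    ∃ v : ℕ → Euc N → Euc N, (∀ n, ContDiff ℝ ∞ (v n)) ∧
      (∀ i, Tendsto (fun n => ∫⁻ x in A, ‖v n x i - u x i‖ₑ) atTop (𝓝 0)) ∧
      ∀ i j, Tendsto (fun n => ∫⁻ x in A, ‖symDeriv (v n) x i j - G x i j‖ₑ) atTop (𝓝 0) := by
  obtain ⟨ι, _, φ, hφ, hsum⟩ := hAl.exists_adapted_partition hA hAb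
  choose hφc hφs hφa using hφ
  have hker := fun (k : ι) (n : ℕ) =>
    (hφa k).exists_kernel (Nat.one_div_pos_of_nat (α := ℝ) (n := n))
  choose κ hκc hκs hκ0 hκ1 hκδ hκA using hker
  set w : ι → Fin N → Euc N → ℝ := fun k i => A.indicator fun y => u y i * φ k y with hw
  set g : ι → Fin N → Fin N → Euc N → ℝ := fun k i j => A.indicator fun y =>
    G y i j * φ k y + (u y i * pderiv j (φ k) y + u y j * pderiv i (φ k) y) / 2 with hg
  have hui := integrableOn_component hu
  have hwi : ∀ k i, Integrable (w k i) := fun k i =>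
    (integrableOn_mul_of_hasCompactSupport (hui i) (hφc k).continuous
      (hφs k)).integrable_indicator hA.measurableSet
  have hup : ∀ k i j, IntegrableOn (fun y => u y i * pderiv j (φ k) y) A := fun k i j =>
    integrableOn_mul_of_hasCompactSupport (hui i) (continuous_pderiv (hφc k) j)
      (hasCompactSupport_pderiv (hφs k) j)
  have hgi : ∀ k i j, Integrable (g k i j) := fun k i j =>
    IntegrableOn.integrable_indicator
      ((integrableOn_mul_of_hasCompactSupport (hG.2.1 i j) (hφc k).continuous (hφs k)).add
        (((hup k i j).add (hup k j i)).div_const 2)) hA.measurableSet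
  have hcw : ∀ k n i, ContDiff ℝ ∞ (κ k n ⋆[ContinuousLinearMap.mul ℝ ℝ] w k i) := fun k n i =>
    contDiff_convolution (hwi k i) (hκc k n) (hκs k n)
  have hconv : ∀ k {f : Euc N → ℝ}, Integrable f → Tendsto (fun n =>
      ∫⁻ x, ‖(κ k n ⋆[ContinuousLinearMap.mul ℝ ℝ] f) x - f x‖ₑ) atTop (𝓝 0) := fun k _ hf =>
    tendsto_convolution hf (hκ0 k) (fun n => (hκc k n).continuous) (hκs k) (hκ1 k) (hκδ k)
  -- hence the terms with `∇φ k` in the product rule cancel in the sum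
  have hdsum : ∀ x ∈ A, ∀ j, ∑ k, pderiv j (φ k) x = 0 := by
    intro x hx j
    rw [← pderiv_sum hφc]
    have : (fun y => ∑ k, φ k y) =ᶠ[𝓝 x] fun _ => (1 : ℝ) := by
      filter_upwards [hA.mem_nhds hx] with y hy using hsum y hy
    rw [pderiv, this.fderiv_eq]
    simp
  refine ⟨fun n x => WithLp.toLp 2 fun i => ∑ k, (κ k n ⋆[ContinuousLinearMap.mul ℝ ℝ] w k i) x,
    fun n => ?_, fun i => ?_, fun i j => ?_⟩
  · rw [contDiff_euclidean]
    exact fun i => ContDiff.sum fun k _ => hcw k n i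
  · refine tendsto_lintegral_enorm_sum_sub hA.measurableSet (fun k n => (hcw k n i).continuous)
      (fun k => hwi k i) (fun k => hconv k (hwi k i)) (fun n x _ => rfl) fun x hx => ?_
    simp only [hw, Set.indicator_of_mem hx]
    rw [← Finset.mul_sum, hsum x hx, mul_one]
  · refine tendsto_lintegral_enorm_sum_sub hA.measurableSet
      (fun k n => (contDiff_convolution (hgi k i j) (hκc k n) (hκs k n)).continuous)
      (fun k => hgi k i j) (fun k => hconv k (hgi k i j)) (fun n x hx => ?_) fun x hx => ?_
    · simp only [symDeriv, Matrix.of_apply]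
      rw [pderiv_sum fun k => hcw k n i, pderiv_sum fun k => hcw k n j, ← Finset.sum_add_distrib,
        Finset.sum_div]
      exact Finset.sum_congr rfl fun k _ => symDeriv_convolution hA hu hG (hφc k) (hφs k)
        (hκc k n) (hκs k n) (hκA k n x hx) i j
    · simp only [hg, Set.indicator_of_mem hx]
      rw [Finset.sum_add_distrib, ← Finset.mul_sum, hsum x hx, ← Finset.sum_div,
        Finset.sum_add_distrib, ← Finset.mul_sum, ← Finset.mul_sum, hdsum x hx, hdsum x hx]
      simp

/-! ### Weak gradients and the energy density -/

theorem contDiff_component {N : ℕ} {v : Euc N → Euc N} (hv : ContDiff ℝ ∞ v) (i : Fin N) :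
    ContDiff ℝ ∞ fun x => v x i :=
  contDiff_euclidean.1 hv i

theorem integrableOn_of_continuous {N : ℕ} {E : Type*} [NormedAddCommGroup E]
    {A : Set (Euc N)} (hAb : Bornology.IsBounded A) {f : Euc N → E} (hf : Continuous f) :
    IntegrableOn f A :=
  (hf.continuousOn.integrableOn_compact hAb.isCompact_closure).mono_set subset_closure

theorem setIntegral_mul_pderiv {N : ℕ} {A : Set (Euc N)} {f φ : Euc N → ℝ}
    (hf : ContDiff ℝ ∞ f) (hφ : IsTest A φ) (j : Fin N) :
    ∫ x in A, f x * pderiv j φ x = -∫ x in A, pderiv j f x * φ x := by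
  have hz : ∀ x ∉ A, φ x = 0 := fun x hx => image_eq_zero_of_notMem_tsupport fun h =>
    hx (hφ.support h)
  have hz' : ∀ x ∉ A, pderiv j φ x = 0 := fun x hx => by
    have : x ∉ tsupport (fderiv ℝ φ) := fun h => hx (hφ.support (tsupport_fderiv_subset ℝ h))
    rw [pderiv, image_eq_zero_of_notMem_tsupport this]
    rfl
  rw [setIntegral_eq_integral_of_forall_compl_eq_zero fun x hx => by rw [hz' x hx, mul_zero],
    setIntegral_eq_integral_of_forall_compl_eq_zero fun x hx => by rw [hz x hx, mul_zero]]
  have hc := hφ.smooth.continuous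
  refine integral_mul_fderiv_eq_neg_fderiv_mul_of_integrable ?_ ?_ ?_
    (fun x _ => hf.differentiable (by simp) x) fun x _ => hφ.smooth.differentiable (by simp) x
  · exact ((continuous_pderiv hf j).mul hc).integrable_of_hasCompactSupport hφ.compact.mul_left
  · exact (hf.continuous.mul (continuous_pderiv hφ.smooth j)).integrable_of_hasCompactSupport
      (hasCompactSupport_pderiv hφ.compact j).mul_left
  · exact (hf.continuous.mul hc).integrable_of_hasCompactSupport hφ.compact.mul_left

theorem hasWeakGrad_of_contDiff {N : ℕ} {A : Set (Euc N)} (hAb : Bornology.IsBounded A)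
    {v : Euc N → Euc N} (hv : ContDiff ℝ ∞ v) :
    HasWeakGrad A v fun x => Matrix.of fun i j => pderiv j (fun y => v y i) x :=
  ⟨fun i j => integrableOn_of_continuous hAb (continuous_pderiv (contDiff_component hv i) j),
    fun i j _ hφ => setIntegral_mul_pderiv (contDiff_component hv i) hφ j⟩

theorem HasWeakGrad.hasWeakSymGrad {N : ℕ} {A : Set (Euc N)} {u : Euc N → Euc N}
    {G : Euc N → Mat N} (hu : IntegrableOn u A) (hG : HasWeakGrad A u G) :
    HasWeakSymGrad A u fun x => Matrix.of fun i j => (G x i j + G x j i) / 2 := by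
  refine ⟨fun x => Matrix.IsSymm.ext fun i j => ?_, fun i j => ?_, fun i j φ hφ => ?_⟩
  · simp [add_comm]
  · exact ((hG.1 i j).add (hG.1 j i)).div_const 2
  · have hui := integrableOn_component hu
    have h1 : ∀ k l, IntegrableOn (fun x => u x k * pderiv l φ x) A := fun k l =>
      integrableOn_mul_of_hasCompactSupport (hui k) (continuous_pderiv hφ.smooth l)
        (hasCompactSupport_pderiv hφ.compact l)
    have h2 : ∀ k l, IntegrableOn (fun x => G x k l * φ x) A := fun k l =>
      integrableOn_mul_of_hasCompactSupport (hG.1 k l) hφ.smooth.continuous hφ.compact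
    rw [integral_div, integral_add (h1 i j) (h1 j i), hG.2 i j φ hφ, hG.2 j i φ hφ]
    have h3 : ∀ x, (Matrix.of fun i j => (G x i j + G x j i) / 2) i j * φ x =
        (G x i j * φ x + G x j i * φ x) / 2 := fun x => by
      rw [Matrix.of_apply]; ring
    simp only [h3]
    rw [integral_div, integral_add (h2 i j) (h2 j i)]
    ring

theorem MemW11.memLD {N : ℕ} {A : Set (Euc N)} {u : Euc N → Euc N} (hu : MemW11 A u) :
    MemLD A u :=
  ⟨hu.1, _, hu.2.choose_spec.hasWeakSymGrad hu.1⟩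

theorem memW11_of_contDiff {N : ℕ} {A : Set (Euc N)} (hAb : Bornology.IsBounded A)
    {v : Euc N → Euc N} (hv : ContDiff ℝ ∞ v) : MemW11 A v :=
  ⟨integrableOn_of_continuous hAb hv.continuous, _, hasWeakGrad_of_contDiff hAb hv⟩

theorem hasWeakSymGrad_symDeriv {N : ℕ} {A : Set (Euc N)} (hAb : Bornology.IsBounded A)
    {v : Euc N → Euc N} (hv : ContDiff ℝ ∞ v) : HasWeakSymGrad A v (symDeriv v) :=
  (hasWeakGrad_of_contDiff hAb hv).hasWeakSymGrad (integrableOn_of_continuous hAb hv.continuous)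

/-- The weak symmetrised gradient is unique up to null sets, so the chosen `symGrad` may be
replaced by any other in the energy. -/
theorem HasWeakSymGrad.ae_eq {N : ℕ} {A : Set (Euc N)} (hA : IsOpen A) {u : Euc N → Euc N}
    {G H : Euc N → Mat N} (hG : HasWeakSymGrad A u G) (hH : HasWeakSymGrad A u H) :
    ∀ᵐ x ∂volume.restrict A, G x = H x := by
  rw [ae_restrict_iff' hA.measurableSet]
  have h : ∀ i j, ∀ᵐ x, x ∈ A → G x i j - H x i j = 0 := by
    intro i j
    refine IsOpen.ae_eq_zero_of_integral_contDiff_smul_eq_zero hA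
      ((hG.2.1 i j).sub (hH.2.1 i j)).locallyIntegrableOn fun φ h1 h2 h3 => ?_
    have hφ : IsTest A φ := ⟨h1, h2, h3⟩
    rw [← setIntegral_eq_integral_of_forall_compl_eq_zero (s := A) fun x hx => by
      rw [image_eq_zero_of_notMem_tsupport fun h => hx (h3 h), zero_smul]]
    have h4 : ∀ x, φ x • (G x i j - H x i j) = G x i j * φ x - H x i j * φ x := fun x => by
      rw [smul_eq_mul]; ring
    simp only [h4]
    rw [integral_sub
      (integrableOn_mul_of_hasCompactSupport (hG.2.1 i j) h1.continuous h2)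
      (integrableOn_mul_of_hasCompactSupport (hH.2.1 i j) h1.continuous h2)]
    have h5 := hG.2.2 i j φ hφ
    rw [hH.2.2 i j φ hφ] at h5
    linarith
  filter_upwards [ae_all_iff.2 fun i => ae_all_iff.2 (h i)] with x hx hxA
  ext i j
  exact sub_eq_zero.1 (hx i j hxA)

theorem hasWeakSymGrad_symGrad {N : ℕ} {A : Set (Euc N)} {u : Euc N → Euc N} (hu : MemLD A u) :
    HasWeakSymGrad A u (symGrad A u) := by
  rw [symGrad, dif_pos hu.2]
  exact hu.2.choose_spec

theorem energy_eq_of_hasWeakSymGrad {N : ℕ} {A : Set (Euc N)} (hA : IsOpen A)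
    {u : Euc N → Euc N} (hu : IntegrableOn u A) {G : Euc N → Mat N} (hG : HasWeakSymGrad A u G)
    (W₀ W₁ : Mat N → ℝ) (χ : Euc N → ℝ) :
    energy W₀ W₁ A χ u = (∫⁻ x in A, ENNReal.ofReal
      (χ x * W₁ (G x) + (1 - χ x) * W₀ (G x))) + totalVar A χ := by
  rw [energy]
  congr 1
  refine lintegral_congr_ae ?_
  filter_upwards [(hasWeakSymGrad_symGrad ⟨hu, G, hG⟩).ae_eq hA hG] with x hx
  rw [hx]

/-- The sum of the absolute values of the entries, an upper bound for the Euclidean norm. -/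
def entrySum {N : ℕ} (ξ : Mat N) : ℝ := ∑ i, ∑ j, |ξ i j|

theorem matNorm_le_entrySum {N : ℕ} (ξ : Mat N) : matNorm ξ ≤ entrySum ξ := by
  rw [matNorm, entrySum]
  refine Real.sqrt_le_iff.2 ⟨by positivity, ?_⟩
  rw [← Finset.sum_product', ← Finset.sum_product']
  calc ∑ p ∈ Finset.univ ×ˢ Finset.univ, ξ p.1 p.2 ^ 2
      = ∑ p ∈ Finset.univ ×ˢ Finset.univ, |ξ p.1 p.2| ^ 2 := by simp only [sq_abs]
    _ ≤ _ := Finset.sum_sq_le_sq_sum_of_nonneg fun p _ => abs_nonneg _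

theorem entrySum_le_add {N : ℕ} (ξ η : Mat N) : entrySum ξ ≤ entrySum η + entrySum (ξ - η) := by
  simp only [entrySum, ← Finset.sum_add_distrib]
  refine Finset.sum_le_sum fun i _ => Finset.sum_le_sum fun j _ => ?_
  calc |ξ i j| = |η i j + (ξ - η) i j| := by rw [Matrix.sub_apply]; congr 1; ring
    _ ≤ _ := abs_add_le _ _

/-- A density that is continuous on symmetric matrices extends continuously to all matrices, by
composition with the symmetric part. -/
theorem exists_continuous_eqOn_symm {N : ℕ} {W : Mat N → ℝ}
    (hW : ContinuousOn W {ξ | ξ.IsSymm}) :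
    ∃ W' : Mat N → ℝ, Continuous W' ∧ ∀ ξ : Mat N, ξ.IsSymm → W' ξ = W ξ := by
  refine ⟨fun ξ => W ((1 / 2 : ℝ) • (ξ + ξ.transpose)), ?_, fun ξ hξ => ?_⟩
  · refine hW.comp_continuous (by fun_prop) fun ξ => ?_
    exact (Matrix.isSymm_add_transpose_self ξ).smul _
  · change W ((1 / 2 : ℝ) • (ξ + ξ.transpose)) = W ξ
    congr 1
    rw [hξ.eq]
    ext i j
    simp
    ring

theorem aemeasurable_comp_of_entries {N : ℕ} {μ : Measure (Euc N)} {W : Mat N → ℝ}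
    (hW : Continuous W) {G : Euc N → Mat N} (hG : ∀ i j, AEMeasurable (fun x => G x i j) μ) :
    AEMeasurable (fun x => W (G x)) μ := by
  have h1 : AEMeasurable (fun x i j => G x i j) μ :=
    aemeasurable_pi_lambda _ fun i => aemeasurable_pi_lambda _ fun j => hG i j
  have h2 : Continuous fun ξ : Fin N → Fin N → ℝ => W (Matrix.of ξ) := hW
  exact h2.measurable.comp_aemeasurable h1

/-! ### The energy along smooth approximations -/

/-- Upper semicontinuity of the bulk energy along strong `L¹` convergence of symmetrised gradients,
in the form that suffices for one good approximation. Write `f` for the density and `S` for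
`entrySum`. Then `f(H) ≤ min (f(H)) (β (1 + S(G))) + β S(H - G)`; on an a.e. convergent
subsequence the integral of the first term tends to that of `f(G)` by dominated convergence, and
that of the second to zero. -/
theorem frequently_lintegral_density_le {N : ℕ} {A : Set (Euc N)} (hAb : Bornology.IsBounded A)
    {W₀ W₁ : Mat N → ℝ}
    (hW₀ : ContinuousOn W₀ {ξ | ξ.IsSymm}) (hW₁ : ContinuousOn W₁ {ξ | ξ.IsSymm}) {β : ℝ}
    (hβ : 0 ≤ β) (hb₀ : ∀ ξ : Mat N, ξ.IsSymm → W₀ ξ ≤ β * (1 + matNorm ξ))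
    (hb₁ : ∀ ξ : Mat N, ξ.IsSymm → W₁ ξ ≤ β * (1 + matNorm ξ)) {χ : Euc N → ℝ}
    (hχm : AEMeasurable χ (volume.restrict A))
    (hχ : ∀ᵐ x ∂volume.restrict A, χ x = 0 ∨ χ x = 1)
    {G : Euc N → Mat N} {H : ℕ → Euc N → Mat N}
    (hGs : ∀ x, (G x).IsSymm) (hHs : ∀ n x, (H n x).IsSymm)
    (hGi : ∀ i j, IntegrableOn (fun x => G x i j) A)
    (hHi : ∀ n i j, IntegrableOn (fun x => H n x i j) A)
    (hHG : ∀ i j, Tendsto (fun n => ∫⁻ x in A, ‖H n x i j - G x i j‖ₑ) atTop (𝓝 0))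
    {ε : ℝ≥0∞} (hε : 0 < ε) :
    ∃ᶠ n in atTop, ∫⁻ x in A, ENNReal.ofReal (χ x * W₁ (H n x) + (1 - χ x) * W₀ (H n x)) ≤
      (∫⁻ x in A, ENNReal.ofReal (χ x * W₁ (G x) + (1 - χ x) * W₀ (G x))) + ε := by
  set μ : Measure (Euc N) := volume.restrict A with hμ
  have : IsFiniteMeasure μ := ⟨by
    rw [hμ, Measure.restrict_apply_univ]
    exact hAb.measure_lt_top⟩
  set f : Euc N → Mat N → ℝ := fun x ξ => χ x * W₁ ξ + (1 - χ x) * W₀ ξ with hf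
  have hfm : ∀ K : Euc N → Mat N, (∀ x, (K x).IsSymm) →
      (∀ i j, AEMeasurable (fun x => K x i j) μ) → AEMeasurable (fun x => f x (K x)) μ := by
    intro K hKs hKm
    obtain ⟨V₀, hV₀, e₀⟩ := exists_continuous_eqOn_symm hW₀
    obtain ⟨V₁, hV₁, e₁⟩ := exists_continuous_eqOn_symm hW₁
    refine ((hχm.mul (aemeasurable_comp_of_entries hV₁ hKm)).add
      (((aemeasurable_const (b := (1 : ℝ))).sub hχm).mul
        (aemeasurable_comp_of_entries hV₀ hKm))).congr
      (ae_of_all _ fun x => ?_)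
    simp [hf, e₀ _ (hKs x), e₁ _ (hKs x)]
  have hfb : ∀ᵐ x ∂μ, ∀ ξ : Mat N, ξ.IsSymm → f x ξ ≤ β * (1 + entrySum ξ) := by
    filter_upwards [hχ] with x hx ξ hξ
    have h1 := matNorm_le_entrySum ξ
    have h2 : β * (1 + matNorm ξ) ≤ β * (1 + entrySum ξ) := by gcongr
    rcases hx with hx | hx
    · simpa [hf, hx] using (hb₀ ξ hξ).trans h2
    · simpa [hf, hx] using (hb₁ ξ hξ).trans h2
  have hSi : ∀ K : Euc N → Mat N, (∀ i j, Integrable (fun x => K x i j) μ) →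
      Integrable (fun x => entrySum (K x)) μ := fun K hK =>
    integrable_finsetSum _ fun i _ => integrable_finsetSum _ fun j _ => (hK i j).abs
  have hdi : ∀ n, Integrable (fun x => entrySum (H n x - G x)) μ := fun n =>
    hSi (fun x => H n x - G x) fun i j => (hHi n i j).sub (hGi i j)
  have hd : Tendsto (fun n => ∫⁻ x, ‖entrySum (H n x - G x)‖ₑ ∂μ) atTop (𝓝 0) := by
    have h0 : Tendsto (fun n => ∑ i, ∑ j, ∫⁻ x, ‖H n x i j - G x i j‖ₑ ∂μ) atTop (𝓝 0) := by
      simpa using tendsto_finsetSum Finset.univ fun i _ =>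
        tendsto_finsetSum Finset.univ fun j _ => hHG i j
    refine tendsto_of_tendsto_of_tendsto_of_le_of_le tendsto_const_nhds h0 (fun _ => zero_le)
      fun n => ?_
    have hm : ∀ i j, AEMeasurable (fun x => ‖H n x i j - G x i j‖ₑ) μ := fun i j =>
      ((hHi n i j).sub (hGi i j)).aestronglyMeasurable.enorm
    have e : ∀ i, ∑ j, ∫⁻ x, ‖H n x i j - G x i j‖ₑ ∂μ = ∫⁻ x, ∑ j, ‖H n x i j - G x i j‖ₑ ∂μ :=
      fun i => (lintegral_finsetSum' _ fun j _ => hm i j).symm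
    simp only [e]
    rw [← lintegral_finsetSum' _ fun i _ => Finset.aemeasurable_fun_sum _ fun j _ => hm i j]
    refine lintegral_mono fun x => (enorm_sum_le _ _).trans ?_
    refine Finset.sum_le_sum fun i _ => (enorm_sum_le _ _).trans (le_of_eq ?_)
    simp
  -- convergence in mean gives pointwise convergence along a subsequence
  obtain ⟨ns, hns, hae⟩ : ∃ ns : ℕ → ℕ, StrictMono ns ∧
      ∀ᵐ x ∂μ, Tendsto (fun k => entrySum (H (ns k) x - G x)) atTop (𝓝 0) := by
    refine TendstoInMeasure.exists_seq_tendsto_ae (f := fun n x => entrySum (H n x - G x))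
      (g := fun _ => 0) (tendstoInMeasure_of_tendsto_eLpNorm one_ne_zero
        (fun n => (hdi n).aestronglyMeasurable) aestronglyMeasurable_const ?_)
    simpa [eLpNorm_one_eq_lintegral_enorm] using hd
  set B : Euc N → ℝ≥0∞ := fun x => ENNReal.ofReal (β * (1 + entrySum (G x))) with hB
  have hBi : Integrable (fun x => β * (1 + entrySum (G x))) μ :=
    ((integrable_const 1).add (hSi G hGi)).const_mul β
  have hBfin : ∫⁻ x, B x ∂μ ≠ ⊤ := hBi.lintegral_lt_top.ne
  have hfG : ∀ᵐ x ∂μ, ENNReal.ofReal (f x (G x)) ≤ B x := by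
    filter_upwards [hfb] with x hx using ENNReal.ofReal_le_ofReal (hx _ (hGs x))
  have hlim : Tendsto (fun k => ∫⁻ x, min (ENNReal.ofReal (f x (H (ns k) x))) (B x) ∂μ) atTop
      (𝓝 (∫⁻ x, ENNReal.ofReal (f x (G x)) ∂μ)) := by
    refine tendsto_lintegral_of_dominated_convergence' B (fun k => ?_)
      (fun k => ae_of_all _ fun x => min_le_right _ _) hBfin ?_
    · exact (hfm _ (hHs _) fun i j => (hHi _ i j).aemeasurable).ennreal_ofReal.min
        hBi.aemeasurable.ennreal_ofReal
    · filter_upwards [hae, hfG] with x hx hxG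
      have hentry : Tendsto (fun k => H (ns k) x) atTop (𝓝[{ξ : Mat N | ξ.IsSymm}] (G x)) := by
        refine tendsto_nhdsWithin_iff.2 ⟨?_, Eventually.of_forall fun k => hHs _ x⟩
        refine tendsto_pi_nhds.2 fun i => tendsto_pi_nhds.2 fun j => ?_
        refine tendsto_iff_norm_sub_tendsto_zero.2
          (squeeze_zero (fun _ => norm_nonneg _) (fun k => ?_) hx)
        calc ‖H (ns k) x i j - G x i j‖ = |(H (ns k) x - G x) i j| := rfl
          _ ≤ ∑ j, |(H (ns k) x - G x) i j| :=
            Finset.single_le_sum (f := fun j => |(H (ns k) x - G x) i j|)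
              (fun _ _ => abs_nonneg _) (Finset.mem_univ j)
          _ ≤ _ := Finset.single_le_sum (f := fun i => ∑ j, |(H (ns k) x - G x) i j|)
              (fun _ _ => Finset.sum_nonneg fun _ _ => abs_nonneg _) (Finset.mem_univ i)
      have h1 : Tendsto (fun k => f x (H (ns k) x)) atTop (𝓝 (f x (G x))) :=
        (((hW₁ _ (hGs x)).tendsto.comp hentry).const_mul _).add
          (((hW₀ _ (hGs x)).tendsto.comp hentry).const_mul _)
      have h2 := (ENNReal.tendsto_ofReal h1).min (tendsto_const_nhds (x := B x))
      rwa [min_eq_left hxG] at h2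
  have hrest : Tendsto (fun k => ENNReal.ofReal β * ∫⁻ x, ‖entrySum (H (ns k) x - G x)‖ₑ ∂μ)
      atTop (𝓝 0) := by
    have := ENNReal.Tendsto.const_mul (a := ENNReal.ofReal β) (hd.comp hns.tendsto_atTop)
      (Or.inr ENNReal.ofReal_ne_top)
    simpa using this
  have hsplit : ∀ k, ∫⁻ x, ENNReal.ofReal (f x (H (ns k) x)) ∂μ ≤
      (∫⁻ x, min (ENNReal.ofReal (f x (H (ns k) x))) (B x) ∂μ) +
        ENNReal.ofReal β * ∫⁻ x, ‖entrySum (H (ns k) x - G x)‖ₑ ∂μ := by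
    intro k
    rw [← lintegral_const_mul' _ _ ENNReal.ofReal_ne_top,
      ← lintegral_add_right' _ ((hdi (ns k)).aestronglyMeasurable.enorm.const_mul _)]
    refine lintegral_mono_ae ?_
    filter_upwards [hfb] with x hx
    rcases le_total (ENNReal.ofReal (f x (H (ns k) x))) (B x) with h | h
    · rw [min_eq_left h]
      exact le_self_add
    · rw [min_eq_right h, hB, Real.enorm_eq_ofReal_abs, ← ENNReal.ofReal_mul hβ]
      refine le_trans ?_ ENNReal.ofReal_add_le
      refine ENNReal.ofReal_le_ofReal ((hx _ (hHs _ x)).trans ?_)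
      have h1 := entrySum_le_add (H (ns k) x) (G x)
      have h2 := le_abs_self (entrySum (H (ns k) x - G x))
      nlinarith
  have hfin : ∫⁻ x, ENNReal.ofReal (f x (G x)) ∂μ ≠ ⊤ :=
    ((lintegral_mono_ae hfG).trans_lt hBfin.lt_top).ne
  have hsum := hlim.add hrest
  rw [add_zero] at hsum
  have hev := hsum.eventually_lt_const (ENNReal.lt_add_right hfin hε.ne')
  exact hns.tendsto_atTop.frequently
    (hev.mono fun k hk => (hsplit k).trans hk.le).frequently

theorem enorm_le_sum_enorm {N : ℕ} (v : Euc N) : ‖v‖ₑ ≤ ∑ i, ‖v i‖ₑ := by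
  have h : v = ∑ i, v i • EuclideanSpace.single i (1 : ℝ) := by
    have := (EuclideanSpace.basisFun (Fin N) ℝ).sum_repr v
    simpa using this.symm
  calc ‖v‖ₑ = ‖∑ i, v i • EuclideanSpace.single i (1 : ℝ)‖ₑ := by rw [← h]
    _ ≤ ∑ i, ‖v i • EuclideanSpace.single i (1 : ℝ)‖ₑ := enorm_sum_le _ _
    _ = ∑ i, ‖v i‖ₑ := by
      refine Finset.sum_congr rfl fun i _ => ?_
      rw [enorm_smul]
      simp [← ofReal_norm]

/-- Every map in `LD(A)` has `L¹`-close approximations in `W^{1,1}(A)` whose energy, with the same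
`χ`, is not much larger. -/
theorem MemLD.exists_memW11_energy_le {N : ℕ} {A : Set (Euc N)} (hA : IsOpen A)
    (hAb : Bornology.IsBounded A) (hAl : LipschitzBoundary A) {W₀ W₁ : Mat N → ℝ}
    (hW₀ : ContinuousOn W₀ {ξ | ξ.IsSymm}) (hW₁ : ContinuousOn W₁ {ξ | ξ.IsSymm}) {β : ℝ}
    (hβ : 0 ≤ β) (hb₀ : ∀ ξ : Mat N, ξ.IsSymm → W₀ ξ ≤ β * (1 + matNorm ξ))
    (hb₁ : ∀ ξ : Mat N, ξ.IsSymm → W₁ ξ ≤ β * (1 + matNorm ξ)) {χ : Euc N → ℝ}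
    (hχ : MemBV01 A χ) {u : Euc N → Euc N} (hu : MemLD A u) {ε : ℝ≥0∞} (hε : 0 < ε) :
    ∃ v, MemW11 A v ∧ ∫⁻ x in A, ‖v x - u x‖ₑ ≤ ε ∧
      energy W₀ W₁ A χ v ≤ energy W₀ W₁ A χ u + ε := by
  obtain ⟨hui, G, hG⟩ := hu
  obtain ⟨v, hv, hvu, hvG⟩ := exists_contDiff_tendsto_symDeriv hA hAb hAl hui hG
  have hH := fun n => hasWeakSymGrad_symDeriv (A := A) hAb (hv n)
  have hW := fun n => memW11_of_contDiff (A := A) hAb (hv n)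
  have hfreq := frequently_lintegral_density_le hAb hW₀ hW₁ hβ hb₀ hb₁
    hχ.1.aemeasurable hχ.2.1 hG.1 (fun n => (hH n).1) hG.2.1 (fun n => (hH n).2.1) hvG hε
  have hsum : Tendsto (fun n => ∑ i, ∫⁻ x in A, ‖v n x i - u x i‖ₑ) atTop (𝓝 0) := by
    simpa using tendsto_finsetSum Finset.univ fun i _ => hvu i
  obtain ⟨n, h1, h2⟩ := (hfreq.and_eventually ((ENNReal.tendsto_nhds_zero.1 hsum) ε hε)).exists
  refine ⟨v n, hW n, le_trans ?_ h2, ?_⟩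
  · have hm : ∀ i, AEMeasurable (fun x => ‖v n x i - u x i‖ₑ) (volume.restrict A) := fun i =>
      ((integrableOn_component (hW n).1 i).sub
        (integrableOn_component hui i)).aestronglyMeasurable.enorm
    rw [← lintegral_finsetSum' _ fun i _ => hm i]
    exact lintegral_mono fun x => enorm_le_sum_enorm (v n x - u x)
  · rw [energy_eq_of_hasWeakSymGrad hA (hW n).1 (hH n), energy_eq_of_hasWeakSymGrad hA hui hG,
      add_right_comm]
    gcongr

theorem relaxedAlong_mono {N : ℕ} {X Y : (Euc N → Euc N) → Prop} (h : ∀ u, X u → Y u)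
    (W₀ W₁ : Mat N → ℝ) (A : Set (Euc N)) (χ : Euc N → ℝ) (u : Euc N → Euc N) :
    relaxedAlong Y W₀ W₁ A χ u ≤ relaxedAlong X W₀ W₁ A χ u :=
  sInf_le_sInf fun _ ⟨un, χn, h1, h2⟩ => ⟨un, χn, fun n => h _ (h1 n), h2⟩

theorem TendstoL1.of_lintegral_sub_le {N : ℕ} {A : Set (Euc N)} {v un : ℕ → Euc N → Euc N}
    {u : Euc N → Euc N} (hv : ∀ n, IntegrableOn (v n) A) (hun : ∀ n, IntegrableOn (un n) A)
    (h : TendstoL1 A un u) {ε : ℕ → ℝ≥0∞} (hε : Tendsto ε atTop (𝓝 0))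
    (hle : ∀ n, ∫⁻ x in A, ‖v n x - un n x‖ₑ ≤ ε n) : TendstoL1 A v u := by
  have h0 := hε.add h
  rw [add_zero] at h0
  refine tendsto_of_tendsto_of_tendsto_of_le_of_le tendsto_const_nhds h0 (fun _ => zero_le)
    fun n => ?_
  calc ∫⁻ x in A, ‖v n x - u x‖ₑ
      ≤ ∫⁻ x in A, (‖v n x - un n x‖ₑ + ‖un n x - u x‖ₑ) := lintegral_mono fun x => by
        rw [← sub_add_sub_cancel (v n x) (un n x) (u x)]
        exact enorm_add_le _ _
    _ = (∫⁻ x in A, ‖v n x - un n x‖ₑ) + ∫⁻ x in A, ‖un n x - u x‖ₑ :=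
        lintegral_add_left' ((hv n).sub (hun n)).aestronglyMeasurable.enorm _
    _ ≤ _ := by
        gcongr
        exact hle n

theorem liminf_le_of_le_add {a b ε : ℕ → ℝ≥0∞} (hε : Tendsto ε atTop (𝓝 0))
    (h : ∀ n, a n ≤ b n + ε n) : liminf a atTop ≤ liminf b atTop := by
  refine ENNReal.le_of_forall_pos_le_add fun η hη _ => ?_
  have h1 : ∀ᶠ n in atTop, a n ≤ b n + η := by
    filter_upwards [(ENNReal.tendsto_nhds_zero.1 hε) η (by exact_mod_cast hη)] with n hn
    exact (h n).trans (by gcongr)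
  refine (liminf_le_liminf h1).trans (le_of_eq ?_)
  exact (Monotone.map_liminf_of_continuousAt (f := fun x : ℝ≥0∞ => x + (η : ℝ≥0∞))
    (fun x y hxy => by dsimp only; gcongr) b (by fun_prop)).symm

end Relax

theorem mainTheorem3 (N : ℕ) (Ω : Set (Relax.Euc N)) (hΩo : IsOpen Ω)
    (hΩb : Bornology.IsBounded Ω) (hΩl : Relax.LipschitzBoundary Ω)
    (W₀ W₁ : Relax.Mat N → ℝ)
    (hW₀ : ContinuousOn W₀ {ξ | ξ.IsSymm}) (hW₁ : ContinuousOn W₁ {ξ | ξ.IsSymm})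
    (hgrowth : ∃ α β : ℝ, 0 < α ∧ 0 < β ∧ ∀ ξ : Relax.Mat N, ξ.IsSymm →
      (α * Relax.matNorm ξ ≤ W₀ ξ ∧ W₀ ξ ≤ β * (1 + Relax.matNorm ξ)) ∧
      (α * Relax.matNorm ξ ≤ W₁ ξ ∧ W₁ ξ ≤ β * (1 + Relax.matNorm ξ)))
    (A : Set (Relax.Euc N)) (hAo : IsOpen A) (hAΩ : A ⊆ Ω) (hAl : Relax.LipschitzBoundary A)
    (χ : Relax.Euc N → ℝ) (hχ : Relax.MemBV01 A χ)
    (u : Relax.Euc N → Relax.Euc N) (hu : Relax.MemBD Ω u) :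
    Relax.relaxedW11 W₀ W₁ A χ u = Relax.relaxedLD W₀ W₁ A χ u := by
  obtain ⟨α, β, -, hβ, hW⟩ := hgrowth
  refine le_antisymm (le_sInf ?_) (Relax.relaxedAlong_mono (fun _ h => h.memLD) _ _ _ _ _)
  rintro ℓ ⟨un, χn, hun, hχn, hu', hχ', rfl⟩
  -- the error `n⁻¹` is infinite for `n = 0`, which is harmless
  have happrox := fun n : ℕ => (hun n).exists_memW11_energy_le hAo (hΩb.subset hAΩ) hAl hW₀ hW₁
    hβ.le (fun ξ hξ => (hW ξ hξ).1.2) (fun ξ hξ => (hW ξ hξ).2.2) (hχn n)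
    (ENNReal.inv_pos.2 (ENNReal.natCast_ne_top n))
  choose v hv hvu hvE using happrox
  calc Relax.relaxedW11 W₀ W₁ A χ u
      ≤ liminf (fun n => Relax.energy W₀ W₁ A (χn n) (v n)) atTop :=
        sInf_le ⟨v, χn, hv, hχn, hu'.of_lintegral_sub_le (fun n => (hv n).1)
          (fun n => (hun n).1) ENNReal.tendsto_inv_nat_nhds_zero hvu, hχ', rfl⟩
    _ ≤ _ := Relax.liminf_le_of_le_add ENNReal.tendsto_inv_nat_nhds_zero hvE
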